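/- Let $d\ge 1$, let $\Gamma\subset\mathbb R^d$ be a bounded open set, $V=H^1_0(\Gamma)$, and let $(\Omega,\mathbb F,\mathbb P)$ be a probability space. Let $a=a(\omega,x)$ be a random conductivity such that, for almost every $\omega$, $a(\omega,\cdot)$ is measurable and is bounded above and bounded away from zero on $\Gamma$ by positive constants which may depend on $\omega$. Let $f(\omega,\cdot)\in L^2(\Gamma)$ almost surely and $g\in L^2(\Gamma)$. Let $\mathcal H\subset(0,\infty)$ be a set of mesh sizes with $h/2\in\mathcal H$ whenever $h\in\mathcal H$, and let $(\mathcal T_h)_{h\in\mathcal H}$ be conforming simplicial meshes in $\overline\Gamma$ such that: $\mathcal T_{h/2}$ refines $\mathcal T_h$; the family is shape regular, i.e. for some constant $\kappa$ every cell $K$ of $\mathcal T_h$ has diameter at most $\kappa h$ and contains a ball of radius $\operatorname{diam}(K)/\kappa$; and every compact subset of $\Gamma$ is covered by $\mathcal T_h$ for all sufficiently small $h$ (this holds trivially if each $\mathcal T_h$ triangulates $\overline\Gamma$). If $\mathcal T_h$ does not cover all of $\Gamma$, "refines" means that the region meshed by $\mathcal T_{h/2}$ contains the region meshed by $\mathcal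 T_h$ and that each cell of $\mathcal T_{h/2}$ lies in a cell of $\mathcal T_h$ or has its interior outside the region meshed by $\mathcal T_h$. Let $V_h\subset V$ be the space of continuous functions that are affine on each simplex of $\mathcal T_h$ and vanish along $\partial\Gamma$ and outside the meshed region. For almost every $\omega$ let $u,\lambda\in V$ solve $$\int_\Gamma a\nabla u\cdot\nabla v\,dx=\int_\Gamma f v\,dx,\qquad \int_\Gamma a\nabla \lambda\cdot\nabla v\,dx=\int_\Gamma g v\,dx\qquad\text{for all } v\in V,$$ and for every $h\in\mathcal H$ let $u_h,\lambda_h\in V_h$ solve the same equations for all $v\in V_h$. Let $\mathcal E(g)=\int_\Gamma g\,(u-u_h)\,dx$ be the Galerkin error at mesh size $h$ and $$F(h)=\int_\Gamma a\,\bigl|\nabla(u_{h/2}-u_h)\cdot\nabla(\lambda_{h/2}-\lambda_h)\bigr|\,dx .$$ Let $\alpha,\beta>0$ be constants, and suppose that there are $c=c(\omega)>0$ and $C=C(\omega)>0$, independent of $h$, and a threshold $h_0=h_0(\omega)$, such that almost surely $$c\le \frac{F(h)}{h^{\alpha+\beta}}\le C\qquad\text{for all } h\in\mathcal H \text{ with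 } h\le h_0 .$$ Then, almost surely, for all $h\in\mathcal H$ with $h\le h_0$, $$|\mathcal E(g)|\le \frac{C\,F(h)}{c\,(1-2^{-\alpha})(1-2^{-\beta})}.$$ -/

import Mathlib

open MeasureTheory Set

noncomputable section

/-- `ℝ^d` with its Euclidean structure. -/
abbrev Space (d : ℕ) : Type := EuclideanSpace ℝ (Fin d)

/-! ### The space `H¹₀(Γ)` -/

/-- Pairs (function, gradient field) in `L²(Γ) × L²(Γ; ℝ^d)`. The function `v` of such a pair is
`v.1`; for elements of `H¹₀(Γ)` below, `v.2` is the weak gradient of `v.1`. -/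
abbrev L2Pair {d : ℕ} (Γ : Set (Space d)) : Type :=
  Lp ℝ 2 (volume.restrict Γ) × Lp (Space d) 2 (volume.restrict Γ)

/-- The pairs `(φ, ∇φ)` with `φ` smooth and compactly supported in `Γ`. -/
def testPairs {d : ℕ} (Γ : Set (Space d)) : Submodule ℝ (L2Pair Γ) where
  carrier := {p | ∃ φ : Space d → ℝ, ContDiff ℝ (⊤ : ℕ∞) φ ∧ HasCompactSupport φ ∧ tsupport φ ⊆ Γ ∧
    p.1 =ᵐ[volume.restrict Γ] φ ∧ p.2 =ᵐ[volume.restrict Γ] gradient φ}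
  zero_mem' := by
    refine ⟨fun _ => 0, contDiff_const, HasCompactSupport.zero, by simp [tsupport], ?_, ?_⟩
    · exact Lp.coeFn_zero _ _ _
    · refine (Lp.coeFn_zero _ _ _).trans (Filter.Eventually.of_forall fun x => ?_)
      simp
  add_mem' := by
    rintro p q ⟨φ, hφ, cφ, sφ, p1, p2⟩ ⟨ψ, hψ, cψ, sψ, q1, q2⟩
    refine ⟨φ + ψ, hφ.add hψ, cφ.add cψ, (tsupport_add φ ψ).trans (union_subset sφ sψ), ?_, ?_⟩
    · exact (Lp.coeFn_add p.1 q.1).trans (p1.add q1)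
    · refine (Lp.coeFn_add p.2 q.2).trans ((p2.add q2).trans (Filter.Eventually.of_forall ?_))
      intro x
      have h1 : DifferentiableAt ℝ φ x := hφ.differentiable (by simp) x
      have h2 : DifferentiableAt ℝ ψ x := hψ.differentiable (by simp) x
      simp [gradient, fderiv_add h1 h2]
  smul_mem' := by
    rintro c p ⟨φ, hφ, cφ, sφ, p1, p2⟩
    refine ⟨c • φ, contDiff_const.smul hφ, cφ.smul_left (f := fun _ => c),
      (tsupport_smul_subset_right (fun _ => c) φ).trans sφ, ?_, ?_⟩
    · exact (Lp.coeFn_smul c p.1).trans (p1.const_smul c)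
    · refine (Lp.coeFn_smul c p.2).trans ((p2.const_smul c).trans (Filter.Eventually.of_forall ?_))
      intro x
      have h1 : DifferentiableAt ℝ φ x := hφ.differentiable (by simp) x
      simp [gradient, fderiv_const_smul h1 c]

/-- `H¹₀(Γ)`: the closure of the test functions in the `H¹`-topology, each element being
represented together with its weak gradient. -/
def H10 {d : ℕ} (Γ : Set (Space d)) : Submodule ℝ (L2Pair Γ) :=
  (testPairs Γ).topologicalClosure

/-! ### Meshes and piecewise linear finite elements -/

/-- The closed cells (simplices of full dimension) of a simplicial complex, given by their
vertices. -/
def cells {d : ℕ} (T : Geometry.SimplicialComplex ℝ (Space d)) : Set (Finset (Space d)) :=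
  {s | s ∈ T.faces ∧ s.card = d + 1}

/-- A conforming simplicial mesh in `Γ`: finitely many simplices, meeting face to face, contained
in the closure of `Γ`, each being a face of a cell. -/
structure IsMesh {d : ℕ} (Γ : Set (Space d)) (T : Geometry.SimplicialComplex ℝ (Space d)) :
    Prop where
  finite : T.faces.Finite
  pure : ∀ s ∈ T.faces, ∃ t ∈ cells T, s ⊆ t
  space_subset : T.space ⊆ closure Γ

/-- The mesh `T'` refines the mesh `T`: the region meshed by `T` is meshed by `T'` as well, and
every cell of `T'` lies in a cell of `T`, unless its interior is outside the region meshed by `T`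
(which cannot happen if both meshes triangulate the same region). -/
structure Refines {d : ℕ} (T' T : Geometry.SimplicialComplex ℝ (Space d)) : Prop where
  space_subset : T.space ⊆ T'.space
  cell_subset : ∀ t ∈ cells T',
    (∃ s ∈ cells T, convexHull ℝ (t : Set (Space d)) ⊆ convexHull ℝ (s : Set (Space d))) ∨
      Disjoint (interior (convexHull ℝ (t : Set (Space d)))) T.space

/-- A nested, shape-regular family of meshes `T h` in `Γ`, indexed by a set `H` of mesh sizes
which is closed under halving. -/
structure IsNestedMeshFamily {d : ℕ} (Γ : Set (Space d)) (H : Set ℝ)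
    (T : ℝ → Geometry.SimplicialComplex ℝ (Space d)) : Prop where
  pos : ∀ h ∈ H, 0 < h
  half_mem : ∀ h ∈ H, h / 2 ∈ H
  mesh : ∀ h ∈ H, IsMesh Γ (T h)
  refines : ∀ h ∈ H, Refines (T (h / 2)) (T h)
  /-- Cells of `T h` have diameter at most `κ h` and contain a ball of comparable radius. -/
  regular : ∃ κ : ℝ, 0 < κ ∧ ∀ h ∈ H, ∀ s ∈ cells (T h),
    Metric.diam (convexHull ℝ (s : Set (Space d))) ≤ κ * h ∧
    ∃ x, Metric.ball x (Metric.diam (convexHull ℝ (s : Set (Space d))) / κ) ⊆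
      convexHull ℝ (s : Set (Space d))
  /-- The meshes fill `Γ`; this holds trivially if each of them triangulates the closure of
  `Γ`. -/
  exhausts : ∀ K : Set (Space d), IsCompact K → K ⊆ Γ →
    ∃ h₁ : ℝ, 0 < h₁ ∧ ∀ h ∈ H, h ≤ h₁ → K ⊆ (T h).space

/-- The finite element space `V_h ⊆ H¹₀(Γ)`: continuous functions which are affine on each simplex
of the mesh and vanish along `∂Γ` (and outside the region which is meshed). -/
def feSpace {d : ℕ} (Γ : Set (Space d)) (T : Geometry.SimplicialComplex ℝ (Space d)) :
    Submodule ℝ (L2Pair Γ) where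
  carrier := {v | v ∈ H10 Γ ∧ ∃ w : Space d → ℝ, Continuous w ∧
    (∀ x, x ∉ Γ ∩ T.space → w x = 0) ∧
    (∀ s ∈ T.faces, ∃ A : Space d →ᵃ[ℝ] ℝ, EqOn w A (convexHull ℝ (s : Set (Space d)))) ∧
    v.1 =ᵐ[volume.restrict Γ] w}
  zero_mem' := ⟨Submodule.zero_mem _, fun _ => 0, continuous_const, fun _ _ => rfl,
    fun _ _ => ⟨0, fun _ _ => rfl⟩, Lp.coeFn_zero _ _ _⟩
  add_mem' := by
    rintro p q ⟨hp, w, cw, zw, aw, ew⟩ ⟨hq, w', cw', zw', aw', ew'⟩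
    refine ⟨Submodule.add_mem _ hp hq, w + w', cw.add cw', fun x hx => ?_, fun s hs => ?_,
      (Lp.coeFn_add p.1 q.1).trans (ew.add ew')⟩
    · simp [zw x hx, zw' x hx]
    · obtain ⟨A, hA⟩ := aw s hs
      obtain ⟨A', hA'⟩ := aw' s hs
      exact ⟨A + A', fun x hx => by simp [hA hx, hA' hx]⟩
  smul_mem' := by
    rintro c p ⟨hp, w, cw, zw, aw, ew⟩
    refine ⟨Submodule.smul_mem _ c hp, c • w, cw.const_smul c, fun x hx => ?_, fun s hs => ?_,
      (Lp.coeFn_smul c p.1).trans (ew.const_smul c)⟩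
    · simp [zw x hx]
    · obtain ⟨A, hA⟩ := aw s hs
      exact ⟨c • A, fun x hx => by simp [hA hx]⟩

/-! ### The boundary value problem, its Galerkin approximation, and the estimator -/

/-- One realisation of the conductivity: measurable, and bounded above and away from zero on
`Γ`. -/
def IsElliptic {d : ℕ} (Γ : Set (Space d)) (a : Space d → ℝ) : Prop :=
  AEMeasurable a (volume.restrict Γ) ∧
    ∃ m M : ℝ, 0 < m ∧ ∀ᵐ x ∂(volume.restrict Γ), m ≤ a x ∧ a x ≤ M

/-- `∫_Γ a ∇v · ∇w dx`. -/
def energyForm {d : ℕ} (Γ : Set (Space d)) (a : Space d → ℝ) (v w : L2Pair Γ) : ℝ :=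
  ∫ x in Γ, a x * inner ℝ (v.2 x) (w.2 x)

/-- `∫_Γ f v dx`. -/
def pairing {d : ℕ} (Γ : Set (Space d)) (f : Space d → ℝ) (v : L2Pair Γ) : ℝ :=
  ∫ x in Γ, f x * v.1 x

/-- `u` solves `∫_Γ a ∇u · ∇v dx = ∫_Γ f v dx` for all `v` in `V`, with `u` in `V`. For
`V = H¹₀(Γ)` this is the weak formulation of `-div (a ∇u) = f`, `u = 0` on `∂Γ`, and for
`V = V_h` the Galerkin formulation. -/
def SolvesIn {d : ℕ} {Γ : Set (Space d)} (V : Submodule ℝ (L2Pair Γ))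
    (a f : Space d → ℝ) (u : L2Pair Γ) : Prop :=
  u ∈ V ∧ ∀ v ∈ V, energyForm Γ a u v = pairing Γ f v

/-- The Galerkin error `(g, u - u_h)`. -/
def galerkinError {d : ℕ} (Γ : Set (Space d)) (g : Space d → ℝ) (u uh : L2Pair Γ) : ℝ :=
  pairing Γ g (u - uh)

/-- The estimator `F(h) = ∫_Γ a |∇(u_{h/2} - u_h) · ∇(λ_{h/2} - λ_h)| dx`. -/
def estimator {d : ℕ} (Γ : Set (Space d)) (a : Space d → ℝ) (u lam : ℝ → L2Pair Γ) (h : ℝ) : ℝ :=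
  ∫ x in Γ, a x * |inner ℝ ((u (h / 2) - u h).2 x) ((lam (h / 2) - lam h).2 x)|

end

open Filter Topology

/-! ### The energy form -/

section EnergyForm

variable {d : ℕ} {Γ : Set (Space d)} {a : Space d → ℝ}

/-! Write `a(·,·)` for the energy form and put `e k = a(λ, u - u_{h/2^k})`. The dual equation makes
`e 0` the Galerkin error. Since the spaces are nested, Galerkin orthogonality gives `e k - e (k+1) =
a(u_{h/2^(k+1)} - u_{h/2^k}, λ_{h/2^(k+1)} - λ_{h/2^k})` (`SolvesIn.energyForm_dual_sub`), which is
at most `F(h/2^k)` in absolute value. The two-sided bound yields `F(h/2^k) ≤ (C/c) F(h)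
2^(-k(α+β))`, so the telescoping sum is dominated by a geometric series
(`abs_le_of_geometric_telescoping`).

This needs `e k → 0`: summability of `F` alone does not identify the limit of the discrete solutions
as `u`. By Céa's lemma it suffices that the spaces `V_h` approximate gradients of elements of `H¹₀`
(`IsNestedMeshFamily.exists_approx`). Test functions are dense by definition, and a test function is
replaced by its nodal interpolant, whose gradient is close by shape regularity and uniform
continuity of the derivative. The interpolant lies in `H¹₀` because it is Lipschitz with compact
support in `Γ`, hence a limit of its mollifications (`mem_H10_of_lipschitzWith`). -/

theorem ae_norm_smul_le {m M : ℝ} (hm : 0 < m)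
    (hM : ∀ᵐ x ∂(volume.restrict Γ), m ≤ a x ∧ a x ≤ M) (v : L2Pair Γ) :
    ∀ᵐ x ∂(volume.restrict Γ), ‖a x • v.2 x‖ ≤ M * ‖v.2 x‖ := by
  filter_upwards [hM] with x hx
  rw [norm_smul, Real.norm_of_nonneg (hm.le.trans hx.1)]
  exact mul_le_mul_of_nonneg_right hx.2 (norm_nonneg _)

theorem memLp_smul (ha : AEMeasurable a (volume.restrict Γ)) {m M : ℝ} (hm : 0 < m)
    (hM : ∀ᵐ x ∂(volume.restrict Γ), m ≤ a x ∧ a x ≤ M) (v : L2Pair Γ) :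
    MemLp (fun x => a x • v.2 x) 2 (volume.restrict Γ) :=
  (Lp.memLp v.2).of_le_mul (ha.aestronglyMeasurable.smul (Lp.aestronglyMeasurable v.2))
    (ae_norm_smul_le hm hM v)

theorem integrable_energy (ha : IsElliptic Γ a) (v w : L2Pair Γ) :
    Integrable (fun x => a x * inner ℝ (v.2 x) (w.2 x)) (volume.restrict Γ) := by
  obtain ⟨hmeas, m, M, hm, hM⟩ := ha
  refine (L2.integrable_inner (𝕜 := ℝ) (memLp_smul hmeas hm hM v).toLp w.2).congr ?_
  filter_upwards [(memLp_smul hmeas hm hM v).coeFn_toLp] with x hx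
  rw [hx, real_inner_smul_left]

theorem energyForm_comm (v w : L2Pair Γ) : energyForm Γ a v w = energyForm Γ a w v := by
  simp only [energyForm, real_inner_comm]

theorem energyForm_sub_right (ha : IsElliptic Γ a) (v w w' : L2Pair Γ) :
    energyForm Γ a v (w - w') = energyForm Γ a v w - energyForm Γ a v w' := by
  unfold energyForm
  rw [← integral_sub (integrable_energy ha v w) (integrable_energy ha v w')]
  refine integral_congr_ae ?_
  filter_upwards [Lp.coeFn_sub w.2 w'.2] with x hx
  rw [Prod.snd_sub, hx, Pi.sub_apply, inner_sub_right, mul_sub]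

theorem energyForm_sub_left (ha : IsElliptic Γ a) (v v' w : L2Pair Γ) :
    energyForm Γ a (v - v') w = energyForm Γ a v w - energyForm Γ a v' w := by
  rw [energyForm_comm, energyForm_sub_right ha, energyForm_comm w, energyForm_comm w]

theorem IsElliptic.exists_bounds (ha : IsElliptic Γ a) : ∃ m M : ℝ, 0 < m ∧ 0 ≤ M ∧
    (∀ v : L2Pair Γ, m * ‖v.2‖ ^ 2 ≤ energyForm Γ a v v) ∧
    ∀ v w : L2Pair Γ, |energyForm Γ a v w| ≤ M * (‖v.2‖ * ‖w.2‖) := by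
  have ha' := ha
  obtain ⟨hmeas, m, M, hm, hM⟩ := ha
  -- If `Γ` is a null set the bounds hold vacuously and `M` may be negative.
  have hM' : ∀ᵐ x ∂(volume.restrict Γ), m ≤ a x ∧ a x ≤ max M 0 :=
    hM.mono fun x hx => ⟨hx.1, hx.2.trans (le_max_left _ _)⟩
  refine ⟨m, max M 0, hm, le_max_right _ _, fun v => ?_, fun v w => ?_⟩
  · have h1 : ‖v.2‖ ^ 2 = ∫ x in Γ, inner ℝ (v.2 x) (v.2 x) := by
      rw [← L2.inner_def, real_inner_self_eq_norm_sq]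
    rw [h1, ← integral_const_mul]
    refine integral_mono_ae ((L2.integrable_inner v.2 v.2).const_mul m)
      (integrable_energy ha' v v) ?_
    filter_upwards [hM] with x hx
    exact mul_le_mul_of_nonneg_right hx.1 real_inner_self_nonneg
  · have hb := memLp_smul hmeas hm hM' v
    have h1 : energyForm Γ a v w = inner ℝ hb.toLp w.2 := by
      rw [L2.inner_def]
      refine integral_congr_ae ?_
      filter_upwards [hb.coeFn_toLp] with x hx
      simp only [hx, real_inner_smul_left]
    rw [h1, ← mul_assoc]
    refine (abs_real_inner_le_norm _ _).trans (mul_le_mul_of_nonneg_right ?_ (norm_nonneg _))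
    refine Lp.norm_le_mul_norm_of_ae_le_mul ?_
    filter_upwards [hb.coeFn_toLp, ae_norm_smul_le hm hM' v] with x hx h2
    rwa [hx]

/-- **Céa's lemma** for the gradient. -/
theorem exists_cea_const (ha : IsElliptic Γ a) : ∃ B : ℝ, 0 ≤ B ∧
    ∀ (f : Space d → ℝ) (V W : Submodule ℝ (L2Pair Γ)) (u uh : L2Pair Γ), W ≤ V →
      SolvesIn V a f u → SolvesIn W a f uh → ∀ v ∈ W, ‖(u - uh).2‖ ≤ B * ‖(u - v).2‖ := by
  obtain ⟨m, M, hm, hM, hcoer, hbdd⟩ := ha.exists_bounds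
  refine ⟨M / m, by positivity, fun f V W u uh hWV hu huh v hv => ?_⟩
  have horth : energyForm Γ a (u - uh) (v - uh) = 0 := by
    have hmem := W.sub_mem hv huh.1
    rw [energyForm_sub_left ha, hu.2 _ (hWV hmem), huh.2 _ hmem, sub_self]
  have h1 : energyForm Γ a (u - uh) (u - uh) = energyForm Γ a (u - uh) (u - v) := by
    rw [← sub_eq_zero, ← energyForm_sub_right ha, ← horth]
    congr 1
    abel
  have h2 : m * ‖(u - uh).2‖ ^ 2 ≤ M * (‖(u - uh).2‖ * ‖(u - v).2‖) :=
    (hcoer _).trans (h1.le.trans ((le_abs_self _).trans (hbdd _ _)))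
  rcases (norm_nonneg (u - uh).2).eq_or_lt with h0 | h0
  · rw [← h0]; positivity
  · rw [div_mul_eq_mul_div, le_div_iff₀ hm]
    refine le_of_mul_le_mul_right ?_ h0
    linarith [h2]

/-- Tested against `u' - u ∈ W'`, the functions `lam` and `l'` give the same value; and `l` may be
subtracted because `u' - u` is energy-orthogonal to the coarse space `W`. -/
theorem SolvesIn.energyForm_dual_sub (ha : IsElliptic Γ a) {f g : Space d → ℝ}
    {V W W' : Submodule ℝ (L2Pair Γ)} {u u' lam l l' : L2Pair Γ} (hWV : W' ≤ V) (hWW : W ≤ W')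
    (hu : SolvesIn W a f u) (hu' : SolvesIn W' a f u') (hlam : SolvesIn V a g lam)
    (hl : SolvesIn W a g l) (hl' : SolvesIn W' a g l') :
    energyForm Γ a lam (u' - u) = energyForm Γ a (u' - u) (l' - l) := by
  have hmem : u' - u ∈ W' := W'.sub_mem hu'.1 (hWW hu.1)
  have h0 : energyForm Γ a (u' - u) l = 0 := by
    rw [energyForm_sub_left ha, hu'.2 _ (hWW hl.1), hu.2 _ hl.1, sub_self]
  rw [energyForm_sub_right ha (u' - u), h0, sub_zero, hlam.2 _ (hWV hmem), ← hl'.2 _ hmem,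
    energyForm_comm]

theorem abs_energyForm_le (ha : IsElliptic Γ a) (v w : L2Pair Γ) :
    |energyForm Γ a v w| ≤ ∫ x in Γ, a x * |inner ℝ (v.2 x) (w.2 x)| := by
  obtain ⟨-, m, M, hm, hM⟩ := ha
  refine (abs_integral_le_integral_abs).trans (le_of_eq (integral_congr_ae ?_))
  filter_upwards [hM] with x hx
  simp only [abs_mul, abs_of_nonneg (hm.le.trans hx.1)]

end EnergyForm

/-! ### The telescoping argument -/

theorem abs_le_of_geometric_telescoping {e F : ℕ → ℝ} {c C s α β : ℝ} (hc : 0 < c) (hC : 0 < C)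
    (hs : 0 < s) (hα : 0 < α) (hβ : 0 < β) (he : Tendsto e atTop (𝓝 0))
    (hstep : ∀ k, |e k - e (k + 1)| ≤ F k) (hlow : c ≤ F 0 / s ^ (α + β))
    (hup : ∀ k, F k / (s / 2 ^ k) ^ (α + β) ≤ C) :
    |e 0| ≤ C * F 0 / (c * (1 - (2 : ℝ) ^ (-α)) * (1 - (2 : ℝ) ^ (-β))) := by
  set x : ℝ := (2 : ℝ) ^ (-α)
  set y : ℝ := (2 : ℝ) ^ (-β)
  have hx0 : 0 < x := Real.rpow_pos_of_pos two_pos _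
  have hy0 : 0 < y := Real.rpow_pos_of_pos two_pos _
  have hx1 : x < 1 := Real.rpow_lt_one_of_one_lt_of_neg one_lt_two (by linarith)
  have hy1 : y < 1 := Real.rpow_lt_one_of_one_lt_of_neg one_lt_two (by linarith)
  have hsp : 0 < s ^ (α + β) := Real.rpow_pos_of_pos hs _
  have hscale : ∀ k : ℕ, (s / 2 ^ k) ^ (α + β) = s ^ (α + β) * (x * y) ^ k := by
    intro k
    rw [Real.div_rpow hs.le (by positivity), div_eq_mul_inv]
    congr 1
    rw [← Real.rpow_add two_pos, ← neg_add, ← Real.rpow_natCast, ← Real.rpow_natCast,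
      ← Real.rpow_mul two_pos.le, ← Real.rpow_mul two_pos.le, ← Real.rpow_neg two_pos.le]
    congr 1
    ring
  -- The lower bound is needed at the coarsest level only, to trade the power of `s` for `F 0`.
  have hF0 : s ^ (α + β) ≤ F 0 / c := by
    rw [le_div_iff₀ hc]
    rw [le_div_iff₀ hsp] at hlow
    linarith
  have hxy0 : 0 ≤ x * y := by positivity
  have hxy1 : x * y < 1 := by nlinarith
  have hFk : ∀ k, F k ≤ C * (F 0 / c) * (x * y) ^ k := by
    intro k
    have h1 := hup k
    rw [hscale, div_le_iff₀ (by positivity)] at h1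
    calc F k ≤ C * (s ^ (α + β) * (x * y) ^ k) := h1
      _ ≤ C * (F 0 / c * (x * y) ^ k) := by gcongr
      _ = _ := by ring
  have hF0' : 0 ≤ F 0 / c := hsp.le.trans hF0
  have hsum : ∀ n, |e 0| ≤ C * (F 0 / c) * (1 - x * y)⁻¹ + |e n| := by
    intro n
    have h1 : e 0 = ∑ k ∈ Finset.range n, (e k - e (k + 1)) + e n := by
      rw [Finset.sum_range_sub']; ring
    have h2 : ∑ k ∈ Finset.range n, (x * y) ^ k ≤ (1 - x * y)⁻¹ :=
      ((hasSum_geometric_of_lt_one hxy0 hxy1).summable.sum_le_tsum _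
        fun _ _ => by positivity).trans (tsum_geometric_of_lt_one hxy0 hxy1).le
    rw [h1]
    refine (abs_add_le _ _).trans (add_le_add ?_ le_rfl)
    calc _ ≤ ∑ k ∈ Finset.range n, C * (F 0 / c) * (x * y) ^ k :=
          (Finset.abs_sum_le_sum_abs _ _).trans
            (Finset.sum_le_sum fun k _ => (hstep k).trans (hFk k))
      _ ≤ _ := by
        rw [← Finset.mul_sum]
        exact mul_le_mul_of_nonneg_left h2 (by positivity)
  have hlim : |e 0| ≤ C * (F 0 / c) * (1 - x * y)⁻¹ := by
    refine ge_of_tendsto' (x := atTop)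
      (f := fun n => C * (F 0 / c) * (1 - x * y)⁻¹ + |e n|) ?_ hsum
    simpa using he.abs.const_add (C * (F 0 / c) * (1 - x * y)⁻¹)
  have hprod : 0 < (1 - x) * (1 - y) := mul_pos (by linarith) (by linarith)
  calc |e 0| ≤ C * (F 0 / c) * (1 - x * y)⁻¹ := hlim
    -- `(1 - x * y) - (1 - x) * (1 - y) = x * (1 - y) + y * (1 - x) ≥ 0`.
    _ ≤ C * (F 0 / c) * ((1 - x) * (1 - y))⁻¹ := by
      gcongr
      nlinarith
    _ = _ := by
      have : (1 - x) ≠ 0 := by linarith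
      have : (1 - y) ≠ 0 := by linarith
      field_simp

/-! ### Cells of a mesh, and nestedness of the finite element spaces -/

section Mesh

variable {d : ℕ}

theorem isClosed_convexHull_finset (s : Finset (Space d)) :
    IsClosed (convexHull ℝ (s : Set (Space d))) :=
  (s.finite_toSet.isCompact_convexHull ℝ).isClosed

theorem affineSpan_cell {T : Geometry.SimplicialComplex ℝ (Space d)} {s : Finset (Space d)}
    (hs : s ∈ cells T) : affineSpan ℝ (s : Set (Space d)) = ⊤ := by
  have h := (T.indep hs.1).affineSpan_eq_top_iff_card_eq_finrank_add_one.2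
    (by simp [hs.2])
  simpa using h

theorem closure_interior_cell {T : Geometry.SimplicialComplex ℝ (Space d)}
    {s : Finset (Space d)} (hs : s ∈ cells T) :
    closure (interior (convexHull ℝ (s : Set (Space d)))) = convexHull ℝ (s : Set (Space d)) := by
  rw [(convex_convexHull ℝ _).closure_interior_eq_closure_of_nonempty_interior
    (interior_convexHull_nonempty_iff_affineSpan_eq_top.2 (affineSpan_cell hs)),
    (isClosed_convexHull_finset s).closure_eq]

theorem feSpace_le_H10 (Γ : Set (Space d)) (T : Geometry.SimplicialComplex ℝ (Space d)) :
    feSpace Γ T ≤ H10 Γ := fun _ h => h.1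

/-- On a fine cell inside a coarse one the affine piece is inherited. On a fine cell whose interior
avoids the coarse region, the function vanishes in the interior and so, by continuity, on the whole
cell. -/
theorem feSpace_mono {Γ : Set (Space d)} {T T' : Geometry.SimplicialComplex ℝ (Space d)}
    (hT : IsMesh Γ T') (href : Refines T' T) : feSpace Γ T ≤ feSpace Γ T' := by
  rintro v ⟨hv, w, cw, zw, aw, ew⟩
  refine ⟨hv, w, cw, fun x hx => zw x fun h => hx ⟨h.1, href.space_subset h.2⟩, fun s hs => ?_, ew⟩
  obtain ⟨t, ht, hst⟩ := hT.pure s hs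
  have hsub : convexHull ℝ (s : Set (Space d)) ⊆ convexHull ℝ (t : Set (Space d)) :=
    convexHull_mono (by exact_mod_cast hst)
  rcases href.cell_subset t ht with ⟨r, hr, htr⟩ | hdisj
  · obtain ⟨A, hA⟩ := aw r hr.1
    exact ⟨A, hA.mono (hsub.trans htr)⟩
  · refine ⟨0, EqOn.mono (hsub.trans (closure_interior_cell ht).ge) ?_⟩
    have h0 : EqOn w (0 : Space d →ᵃ[ℝ] ℝ) (interior (convexHull ℝ (t : Set (Space d)))) :=
      fun x hx => zw x fun h => hdisj.le_bot ⟨hx, h.2⟩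
    exact h0.closure cw (AffineMap.continuous_of_finiteDimensional _)

theorem IsNestedMeshFamily.div_pow_mem {Γ : Set (Space d)} {H : Set ℝ}
    {T : ℝ → Geometry.SimplicialComplex ℝ (Space d)} (hT : IsNestedMeshFamily Γ H T) {h : ℝ}
    (hh : h ∈ H) (k : ℕ) : h / 2 ^ k ∈ H := by
  induction k with
  | zero => simpa
  | succ k ih => rw [pow_succ, ← div_div]; exact hT.half_mem _ ih

theorem IsMesh.exists_cell {Γ : Set (Space d)} {T : Geometry.SimplicialComplex ℝ (Space d)}
    (hT : IsMesh Γ T) {x : Space d} (hx : x ∈ T.space) :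
    ∃ s ∈ cells T, x ∈ convexHull ℝ (s : Set (Space d)) := by
  obtain ⟨s, hs, hxs⟩ := Geometry.SimplicialComplex.mem_space_iff.1 hx
  obtain ⟨t, ht, hst⟩ := hT.pure s hs
  exact ⟨t, ht, convexHull_mono (by exact_mod_cast hst) hxs⟩

theorem cells_finite {Γ : Set (Space d)} {T : Geometry.SimplicialComplex ℝ (Space d)}
    (hT : IsMesh Γ T) : (cells T).Finite := hT.finite.subset fun _ h => h.1

theorem isClosed_space {Γ : Set (Space d)} {T : Geometry.SimplicialComplex ℝ (Space d)}
    (hT : IsMesh Γ T) : IsClosed T.space :=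
  hT.finite.isClosed_biUnion fun s _ => isClosed_convexHull_finset s

/-- An affine function with prescribed values at the vertices of a simplex. -/
theorem exists_affineMap_eqOn {T : Geometry.SimplicialComplex ℝ (Space d)} {s : Finset (Space d)}
    (hs : s ∈ cells T) (φ : Space d → ℝ) : ∃ A : Space d →ᵃ[ℝ] ℝ, ∀ v ∈ s, A v = φ v := by
  classical
  let b : AffineBasis {x // x ∈ s} ℝ (Space d) := ⟨fun i => (i : Space d), T.indep hs.1,
    by simpa using affineSpan_cell hs⟩
  refine ⟨∑ i : {x // x ∈ s}, φ i • b.coord i, fun v hv => ?_⟩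
  have h1 : ∀ i : {x // x ∈ s}, b.coord i v = if i = ⟨v, hv⟩ then 1 else 0 := fun i =>
    b.coord_apply i ⟨v, hv⟩
  have h2 : ∀ F : Finset {x // x ∈ s},
      (∑ i ∈ F, φ i • b.coord i) v = ∑ i ∈ F, φ i * b.coord i v := by
    intro F
    induction F using Finset.induction_on with
    | empty => simp
    | insert i F hi ih => simp [Finset.sum_insert hi, ih]
  simp [h2, h1]

/-- Almost every point is in the interior of a cell or outside the meshed region. -/
theorem IsMesh.ae_mem_interior {Γ : Set (Space d)}
    {T : Geometry.SimplicialComplex ℝ (Space d)} (hT : IsMesh Γ T) :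
    ∀ᵐ x : Space d, x ∉ T.space ∨
      ∃ s ∈ cells T, x ∈ interior (convexHull ℝ (s : Set (Space d))) := by
  have h : ∀ᵐ x : Space d, ∀ s ∈ cells T, x ∉ frontier (convexHull ℝ (s : Set (Space d))) :=
    (ae_ball_iff (cells_finite hT).countable).2 fun s _ =>
      measure_eq_zero_iff_ae_notMem.1 ((convex_convexHull ℝ _).addHaar_frontier volume)
  filter_upwards [h] with x hx
  by_contra! hcon
  obtain ⟨s, hs, hxs⟩ := hT.exists_cell hcon.1
  exact hx s hs ⟨subset_closure hxs, hcon.2 s hs⟩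

end Mesh

/-! ### Lipschitz functions with compact support belong to `H¹₀` -/

/-- A continuous function which is `K`-Lipschitz on each member of a finite closed cover is
`K`-Lipschitz. -/
theorem lipschitzWith_of_finite_closed_cover {E ι : Type*} [NormedAddCommGroup E]
    [NormedSpace ℝ E] [Finite ι] {S : ι → Set E} (hS : ∀ i, IsClosed (S i))
    (hcov : ∀ x, ∃ i, x ∈ S i) {w : E → ℝ} (hw : Continuous w) {K : NNReal}
    (hK : ∀ i, LipschitzOnWith K w (S i)) : LipschitzWith K w := by
  refine LipschitzWith.of_dist_le_mul fun x y => ?_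
  rw [dist_comm, Real.dist_eq, dist_eq_norm', ← Real.norm_eq_abs]
  set γ : ℝ → E := fun t => AffineMap.lineMap x y t
  have hγ : Continuous γ := AffineMap.lineMap_continuous
  have hγd : ∀ s t, dist (γ s) (γ t) = |s - t| * ‖y - x‖ := fun s t => by
    rw [dist_lineMap_lineMap, Real.dist_eq, dist_comm, dist_eq_norm]
  set L : ℝ := K * ‖y - x‖
  set p : ℝ → ℝ := fun t => w (γ t) - w x
  have hp : Continuous p := by fun_prop
  -- The growth of `w` along the segment is fenced by a line; the slack `ε` supplies the strict
  -- inequality of slopes.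
  have key : ∀ ε > 0, ‖p 1‖ ≤ (L + ε) * 1 := by
    intro ε hε
    refine image_norm_le_of_liminf_right_slope_norm_lt_deriv_boundary (a := 0) (b := 1)
      (f := p) (f' := fun _ => L) (B := fun t => (L + ε) * t) (B' := fun _ => L + ε)
      hp.continuousOn ?_ ?_ (by fun_prop) ?_ ?_ (right_mem_Icc.2 zero_le_one)
    · intro t _ r hr
      -- By finiteness one member of the cover is met arbitrarily close to the right of `t`; being
      -- closed, it also contains `γ t`, so the Lipschitz bound on it controls the slope.
      have h1 : ∃ i, ∃ᶠ z in 𝓝[>] t, γ z ∈ S i := by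
        by_contra! hcon
        obtain ⟨z, hz⟩ := (eventually_all.2 hcon).exists
        obtain ⟨i, hi⟩ := hcov (γ z)
        exact hz i hi
      obtain ⟨i, hi⟩ := h1
      have hti : γ t ∈ S i :=
        (hS i).mem_of_frequently_of_tendsto hi (hγ.continuousAt.tendsto.mono_left inf_le_left)
      refine (hi.and_eventually self_mem_nhdsWithin).mono ?_
      rintro z ⟨hz, htz⟩
      have htz' : 0 < z - t := sub_pos.2 htz
      rw [slope_def_field, div_lt_iff₀ htz']
      have h2 := (hK i).dist_le_mul _ hz _ hti
      rw [hγd, abs_of_pos htz', Real.dist_eq] at h2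
      calc ‖p z‖ - ‖p t‖ ≤ ‖p z - p t‖ := norm_sub_norm_le _ _
        _ = |w (γ z) - w (γ t)| := by simp [p]
        _ ≤ L * (z - t) := by simp only [L]; linarith
        _ < r * (z - t) := mul_lt_mul_of_pos_right hr htz'
    · simp [p, γ]
    · intro t _
      simpa using ((hasDerivAt_id t).const_mul (L + ε)).hasDerivWithinAt
    · intro t _ _
      linarith
  have h3 : ‖p 1‖ ≤ L := le_of_forall_pos_le_add fun ε hε => by simpa using key ε hε
  simpa [p, γ] using h3

/-- Bounded almost everywhere convergence implies convergence in `L²`. -/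
theorem tendsto_L2_of_ae_of_bound {X E : Type*} [MeasurableSpace X] {μ : Measure X}
    [IsFiniteMeasure μ] [NormedAddCommGroup E] [InnerProductSpace ℝ E] {F : ℕ → Lp E 2 μ}
    {G : Lp E 2 μ} {B : ℝ} (hB : ∀ᶠ n in atTop, ∀ᵐ x ∂μ, ‖F n x‖ ≤ B) (hG : ∀ᵐ x ∂μ, ‖G x‖ ≤ B)
    (hlim : ∀ᵐ x ∂μ, Tendsto (fun n => F n x) atTop (𝓝 (G x))) : Tendsto F atTop (𝓝 G) := by
  rw [tendsto_iff_norm_sub_tendsto_zero]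
  have h1 : ∀ n, ‖F n - G‖ ^ 2 = ∫ x, ‖(F n - G) x‖ ^ 2 ∂μ := fun n => by
    rw [← real_inner_self_eq_norm_sq, L2.inner_def]
    simp only [real_inner_self_eq_norm_sq]
  have h2 : Tendsto (fun n => ‖F n - G‖ ^ 2) atTop (𝓝 0) := by
    simp only [h1]
    have h0 : (0 : ℝ) = ∫ _, (0 : ℝ) ∂μ := by simp
    rw [h0]
    refine tendsto_integral_filter_of_dominated_convergence (fun _ => (B + B) ^ 2) ?_ ?_
      (integrable_const _) ?_
    · exact Eventually.of_forall fun n => (Lp.aestronglyMeasurable _).norm.pow 2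
    · filter_upwards [hB] with n hn
      filter_upwards [hn, hG, Lp.coeFn_sub (F n) G] with x hx hGx hs
      rw [hs, Pi.sub_apply, Real.norm_of_nonneg (by positivity)]
      gcongr
      exact (norm_sub_le _ _).trans (add_le_add hx hGx)
    · filter_upwards [hlim, ae_all_iff.2 fun n => Lp.coeFn_sub (F n) G] with x hx hs
      simp only [hs, Pi.sub_apply]
      simpa using (tendsto_iff_norm_sub_tendsto_zero.1 hx).pow 2
  simpa [Real.sqrt_sq (norm_nonneg _)] using h2.sqrt

section Mollify

open scoped Convolution
open ContinuousLinearMap (lsmul)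

variable {d : ℕ}

/-- By Rademacher's theorem `w` is differentiable almost everywhere, and `K * |ρ|` dominates the
difference quotients, so the derivative may fall on `w`. -/
theorem hasFDerivAt_convolution_of_lipschitzWith {ρ w : Space d → ℝ} (hρ : Continuous ρ)
    (hc : HasCompactSupport ρ) {K : NNReal} (hw : LipschitzWith K w) (x : Space d) :
    HasFDerivAt (ρ ⋆[lsmul ℝ ℝ, volume] w) ((ρ ⋆[lsmul ℝ ℝ, volume] (fderiv ℝ w)) x) x := by
  have hint : ∀ z, Continuous fun t => ρ t • w (z - t) := fun z =>
    hρ.smul (hw.continuous.comp (by fun_prop))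
  refine (hasFDerivAt_integral_of_dominated_loc_of_lip (μ := volume)
    (F := fun z t => ρ t • w (z - t)) (F' := fun t => ρ t • fderiv ℝ w (x - t))
    (bound := fun t => K * |ρ t|) (s := univ) univ_mem ?_ ?_ ?_ ?_ ?_ ?_).2
  · exact Eventually.of_forall fun z => (hint z).aestronglyMeasurable
  · exact (hint x).integrable_of_hasCompactSupport hc.smul_right
  · exact hρ.aestronglyMeasurable.smul
      ((measurable_fderiv ℝ w).comp (measurable_const.sub measurable_id)).aestronglyMeasurable
  · refine Eventually.of_forall fun t => LipschitzOnWith.of_dist_le_mul fun y _ z _ => ?_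
    have h1 := hw.dist_le_mul (y - t) (z - t)
    rw [dist_sub_right] at h1
    rw [dist_smul₀, Real.norm_eq_abs, Real.coe_nnabs, abs_of_nonneg (show 0 ≤ (K : ℝ) * |ρ t| by positivity)]
    nlinarith [mul_le_mul_of_nonneg_left h1 (abs_nonneg (ρ t))]
  · exact (((hρ.integrable_of_hasCompactSupport hc).abs).const_mul _)
  · have h1 : ∀ᵐ t : Space d, DifferentiableAt ℝ w (x - t) :=
      (Measure.measurePreserving_sub_left volume x).quasiMeasurePreserving.ae
        (hw.ae_differentiableAt (μ := volume))
    filter_upwards [h1] with t ht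
    exact (ht.hasFDerivAt.comp x (hasFDerivAt_sub_const t)).const_smul (ρ t)

theorem norm_gradient {f : Space d → ℝ} (x : Space d) : ‖gradient f x‖ = ‖fderiv ℝ f x‖ := by
  simp [gradient]

/-- Mollifications with small radius are test functions in `Γ`. They and their gradients are
uniformly bounded and converge almost everywhere by Lebesgue differentiation, hence in `L²` of the
bounded set `Γ`. -/
theorem mem_H10_of_lipschitzWith {Γ : Set (Space d)} (hΓ : IsOpen Γ)
    (hΓb : Bornology.IsBounded Γ) {w : Space d → ℝ} {K : NNReal} (hw : LipschitzWith K w)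
    (hwc : HasCompactSupport w) (hwΓ : tsupport w ⊆ Γ) {p : L2Pair Γ}
    (hp1 : p.1 =ᵐ[volume.restrict Γ] w) (hp2 : p.2 =ᵐ[volume.restrict Γ] gradient w) :
    p ∈ H10 Γ := by
  have hfin : IsFiniteMeasure (volume.restrict Γ) := ⟨by simpa using hΓb.measure_lt_top⟩
  obtain ⟨δ, hδ, hδΓ⟩ := hwc.isCompact.exists_cthickening_subset_open hΓ hwΓ
  have hr : ∀ n : ℕ, 0 < δ / (n + 1 : ℝ) := fun n => by positivity
  -- The fixed ratio of inner and outer radius is what Lebesgue differentiation requires; outer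
  -- radii at most `δ` keep supports in `Γ`.
  let b : ℕ → ContDiffBump (0 : Space d) := fun n =>
    ⟨δ / (n + 1) / 2, δ / (n + 1), by linarith [hr n], by linarith [hr n]⟩
  let φ : ℕ → Space d → ℝ := fun n => (b n).normed volume ⋆[lsmul ℝ ℝ, volume] w
  have hlip : LocallyIntegrable w volume := hw.continuous.locallyIntegrable
  have hfd : LocallyIntegrable (fderiv ℝ w) volume := by
    refine (locallyIntegrable_const (K : ℝ)).mono
      (measurable_fderiv ℝ w).aestronglyMeasurable (Eventually.of_forall fun x => ?_)
    simpa using norm_fderiv_le_of_lipschitz ℝ hw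
  have hrout : Tendsto (fun n => (b n).rOut) atTop (𝓝 0) := by
    simpa [b, Function.comp_def] using
      (tendsto_const_div_atTop_nhds_zero_nat δ).comp (tendsto_add_atTop_nat 1)
  have hrin : ∀ᶠ n in atTop, (b n).rOut ≤ 2 * (b n).rIn :=
    Eventually.of_forall fun n => by simp only [b]; linarith
  have hφsm : ∀ n, ContDiff ℝ (⊤ : ℕ∞) (φ n) := fun n =>
    (b n).hasCompactSupport_normed.contDiff_convolution_left _ (b n).contDiff_normed hlip
  have hφc : ∀ n, HasCompactSupport (φ n) := fun n =>
    (b n).hasCompactSupport_normed.convolution _ hwc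
  have hφsupp : ∀ n, tsupport (φ n) ⊆ Γ := by
    intro n
    refine subset_trans (closure_minimal ?_ Metric.isClosed_cthickening) hδΓ
    refine (support_convolution_subset _).trans ?_
    rw [ContDiffBump.support_normed_eq]
    rintro _ ⟨y, hy, z, hz, rfl⟩
    refine Metric.mem_cthickening_of_dist_le _ z _ _ (subset_tsupport w hz) ?_
    have h1 : (b n).rOut ≤ δ := div_le_self hδ.le (by simp)
    simpa using (mem_ball_zero_iff.1 hy).le.trans h1
  have hφd : ∀ n x, fderiv ℝ (φ n) x =
      ((b n).normed volume ⋆[lsmul ℝ ℝ, volume] (fderiv ℝ w)) x := fun n x =>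
    (hasFDerivAt_convolution_of_lipschitzWith (b n).continuous_normed
      (b n).hasCompactSupport_normed hw x).fderiv
  obtain ⟨B, hB⟩ := hw.continuous.norm.bddAbove_range_of_hasCompactSupport hwc.norm
  have hwB : ∀ x, ‖w x‖ ≤ B := fun x => hB (mem_range_self x)
  have hbound : ∀ {F : Type} [NormedAddCommGroup F] [NormedSpace ℝ F] (q : Space d → F) (R : ℝ),
      (∀ x, ‖q x‖ ≤ R) → ∀ n x, ‖((b n).normed volume ⋆[lsmul ℝ ℝ, volume] q) x‖ ≤ R := by
    intro F _ _ q R hq n x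
    calc ‖∫ t, (b n).normed volume t • q (x - t)‖
        ≤ ∫ t, (b n).normed volume t * R := by
          refine norm_integral_le_of_norm_le ((b n).integrable_normed.mul_const R)
            (Eventually.of_forall fun t => ?_)
          rw [norm_smul, Real.norm_of_nonneg ((b n).nonneg_normed t)]
          exact mul_le_mul_of_nonneg_left (hq _) ((b n).nonneg_normed t)
      _ = R := by rw [integral_mul_const, (b n).integral_normed, one_mul]
  have hφB : ∀ n x, ‖φ n x‖ ≤ B := hbound w B hwB
  have hφK : ∀ n x, ‖gradient (φ n) x‖ ≤ K := fun n x => by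
    rw [norm_gradient, hφd]
    exact hbound _ K (fun _ => norm_fderiv_le_of_lipschitz ℝ hw) n x
  have hgrad : ∀ n, Continuous (gradient (φ n)) := fun n =>
    (InnerProductSpace.toDual ℝ (Space d)).symm.continuous.comp
      ((hφsm n).continuous_fderiv (by simp))
  have hm1 : ∀ n, MemLp (φ n) 2 (volume.restrict Γ) := fun n =>
    MemLp.of_bound (hφsm n).continuous.aestronglyMeasurable B (Eventually.of_forall (hφB n))
  have hm2 : ∀ n, MemLp (gradient (φ n)) 2 (volume.restrict Γ) := fun n =>
    MemLp.of_bound (hgrad n).aestronglyMeasurable K (Eventually.of_forall (hφK n))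
  refine mem_closure_of_tendsto (b := atTop) (f := fun n => ((hm1 n).toLp, (hm2 n).toLp)) ?_
    (Eventually.of_forall fun n => ⟨φ n, hφsm n, hφc n, hφsupp n, (hm1 n).coeFn_toLp,
      (hm2 n).coeFn_toLp⟩)
  refine Tendsto.prodMk_nhds (x := p.1) (y := p.2) ?_ ?_
  · refine tendsto_L2_of_ae_of_bound (B := B) (Eventually.of_forall fun n => ?_) ?_ ?_
    · filter_upwards [(hm1 n).coeFn_toLp] with x hx
      rw [hx]; exact hφB n x
    · filter_upwards [hp1] with x hx
      rw [hx]; exact hwB x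
    · filter_upwards [hp1, ae_all_iff.2 fun n => (hm1 n).coeFn_toLp, ae_restrict_of_ae
        (ContDiffBump.ae_convolution_tendsto_right_of_locallyIntegrable hrout hrin hlip)]
        with x h1 h2 h3
      simpa only [h1, h2] using h3
  · refine tendsto_L2_of_ae_of_bound (B := K) (Eventually.of_forall fun n => ?_) ?_ ?_
    · filter_upwards [(hm2 n).coeFn_toLp] with x hx
      rw [hx]; exact hφK n x
    · filter_upwards [hp2] with x hx
      rw [hx, norm_gradient]; exact norm_fderiv_le_of_lipschitz ℝ hw
    · filter_upwards [hp2, ae_all_iff.2 fun n => (hm2 n).coeFn_toLp, ae_restrict_of_ae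
        (ContDiffBump.ae_convolution_tendsto_right_of_locallyIntegrable hrout hrin hfd)]
        with x h1 h2 h3
      simp only [h1, h2, gradient, hφd]
      exact ((InnerProductSpace.toDual ℝ (Space d)).symm.continuous.tendsto _).comp h3

end Mollify

/-! ### Piecewise affine interpolation -/

section Interpolation

variable {d : ℕ}

theorem AffineMap.hasFDerivAt_toContinuousLinearMap (A : Space d →ᵃ[ℝ] ℝ) (x : Space d) :
    HasFDerivAt A (LinearMap.toContinuousLinearMap A.linear) x := by
  rw [A.decomp]
  exact (LinearMap.toContinuousLinearMap A.linear).hasFDerivAt.add_const (A 0)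

theorem AffineMap.lipschitzWith_nnnorm_linear (A : Space d →ᵃ[ℝ] ℝ) :
    LipschitzWith ‖LinearMap.toContinuousLinearMap A.linear‖₊ A := by
  refine LipschitzWith.of_dist_le_mul fun x y => ?_
  have h := (LinearMap.toContinuousLinearMap A.linear).le_opNorm (x - y)
  have h1 : A.linear (x - y) = A x - A y := A.linearMap_vsub x y
  rw [LinearMap.coe_toContinuousLinearMap', h1] at h
  simpa [dist_eq_norm] using h

theorem eqOn_zero_convexHull {A : Space d →ᵃ[ℝ] ℝ} {s : Set (Space d)} (h : ∀ v ∈ s, A v = 0)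
    {x : Space d} (hx : x ∈ convexHull ℝ s) : A x = 0 :=
  convexHull_min (t := A ⁻¹' {0}) h ((convex_singleton (0 : ℝ)).affine_preimage A) hx

theorem dist_le_diam_convexHull (s : Finset (Space d)) {x y : Space d}
    (hx : x ∈ convexHull ℝ (s : Set (Space d))) (hy : y ∈ convexHull ℝ (s : Set (Space d))) :
    dist x y ≤ Metric.diam (convexHull ℝ (s : Set (Space d))) :=
  Metric.dist_le_diam_of_mem (s.finite_toSet.isCompact_convexHull ℝ).isBounded hx hy

/-- This fails for `d = 0`, where a cell is a single point. -/
theorem diam_cell_pos (hd : 1 ≤ d) {T : Geometry.SimplicialComplex ℝ (Space d)}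
    {s : Finset (Space d)} (hs : s ∈ cells T) :
    0 < Metric.diam (convexHull ℝ (s : Set (Space d))) := by
  obtain ⟨x, hx, y, hy, hxy⟩ := Finset.one_lt_card.1 (show 1 < s.card by rw [hs.2]; omega)
  exact (dist_pos.2 hxy).trans_le (dist_le_diam_convexHull s (subset_convexHull ℝ _ hx)
    (subset_convexHull ℝ _ hy))

/-- The gradient of the affine interpolant on a simplex containing a ball of comparable size. -/
theorem norm_linear_interpolant_sub_fderiv_le {s : Finset (Space d)} {κ ε : ℝ} (hκ : 0 < κ)
    (hD : 0 < Metric.diam (convexHull ℝ (s : Set (Space d)))) {x₀ : Space d}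
    (hball : Metric.ball x₀ (Metric.diam (convexHull ℝ (s : Set (Space d))) / κ) ⊆
      convexHull ℝ (s : Set (Space d)))
    {φ : Space d → ℝ} (hφ : Differentiable ℝ φ)
    (hε : ∀ x ∈ convexHull ℝ (s : Set (Space d)), ∀ y ∈ convexHull ℝ (s : Set (Space d)),
      ‖fderiv ℝ φ x - fderiv ℝ φ y‖ ≤ ε)
    {A : Space d →ᵃ[ℝ] ℝ} (hA : ∀ v ∈ s, A v = φ v) {x : Space d}
    (hx : x ∈ convexHull ℝ (s : Set (Space d))) :
    ‖LinearMap.toContinuousLinearMap A.linear - fderiv ℝ φ x‖ ≤ (4 * κ + 1) * ε := by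
  set D := Metric.diam (convexHull ℝ (s : Set (Space d)))
  have hx₀ : x₀ ∈ convexHull ℝ (s : Set (Space d)) :=
    hball (Metric.mem_ball_self (by positivity))
  set ψ := fderiv ℝ φ x₀
  have hε0 : 0 ≤ ε := (norm_nonneg _).trans (hε x hx x hx)
  -- `B` is `A` minus the first-order Taylor polynomial of `φ` at `x₀`. The mean value inequality
  -- bounds it at the vertices, and affinity carries the bound to the whole simplex.
  let B : Space d →ᵃ[ℝ] ℝ :=
    A - (ψ : Space d →ₗ[ℝ] ℝ).toAffineMap - AffineMap.const ℝ (Space d) (φ x₀ - ψ x₀)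
  have hB : ∀ y, B y = A y - φ x₀ - ψ (y - x₀) := fun y => by
    simp [B]; ring
  have hBv : ∀ v ∈ (s : Set (Space d)), B v ∈ Icc (-(ε * D)) (ε * D) := by
    intro v hv
    have hvs := subset_convexHull ℝ (s : Set (Space d)) hv
    rw [mem_Icc, ← abs_le, hB, hA v hv, ← Real.norm_eq_abs]
    refine ((convex_convexHull ℝ (s : Set (Space d))).norm_image_sub_le_of_norm_fderiv_le'
      (fun y _ => hφ y) (fun y hy => hε y hy x₀ hx₀) hx₀ hvs).trans ?_
    rw [← dist_eq_norm]
    exact mul_le_mul_of_nonneg_left (dist_le_diam_convexHull s hvs hx₀) hε0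
  have hBs : ∀ y ∈ convexHull ℝ (s : Set (Space d)), |B y| ≤ ε * D := fun y hy =>
    abs_le.2 (convexHull_min (t := B ⁻¹' Icc (-(ε * D)) (ε * D)) hBv
      ((convex_Icc _ _).affine_preimage B) hy)
  -- Half the radius of the inscribed ball is used, so that the closed ball fits into the open one.
  have h1 : ‖LinearMap.toContinuousLinearMap A.linear - ψ‖ ≤ 2 * (ε * D) / (D / (2 * κ)) := by
    refine ContinuousLinearMap.opNorm_bound_of_ball_bound (by positivity) _ _ fun z hz => ?_
    have hz' : x₀ + z ∈ convexHull ℝ (s : Set (Space d)) := by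
      refine hball ?_
      rw [Metric.mem_ball, dist_self_add_left]
      refine (mem_closedBall_zero_iff.1 hz).trans_lt ?_
      gcongr
      linarith
    have h2 : (LinearMap.toContinuousLinearMap A.linear - ψ) z = B (x₀ + z) - B x₀ := by
      have h3 : A (x₀ + z) = A.linear z + A x₀ := by
        rw [add_comm]; exact A.map_vadd x₀ z
      rw [hB, hB, h3]
      simp
      ring
    rw [h2, Real.norm_eq_abs]
    refine (abs_sub _ _).trans ?_
    linarith [hBs _ hz', hBs _ hx₀]
  have h4 : 2 * (ε * D) / (D / (2 * κ)) = 4 * κ * ε := by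
    field_simp
    ring
  calc _ = ‖(LinearMap.toContinuousLinearMap A.linear - ψ) - (fderiv ℝ φ x - ψ)‖ := by
        congr 1; abel
    _ ≤ 4 * κ * ε + ε := (norm_sub_le _ _).trans
        (add_le_add (h1.trans h4.le) (hε x hx x₀ hx₀))
    _ = _ := by ring

theorem norm_gradient_sub_gradient (w φ : Space d → ℝ) (x : Space d) :
    ‖gradient w x - gradient φ x‖ = ‖fderiv ℝ w x - fderiv ℝ φ x‖ := by
  simp only [gradient, ← map_sub, LinearIsometryEquiv.norm_map]

/-- Nodal values are glued to a piecewise affine function on the meshed region. -/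
theorem exists_piecewise_affine {Γ : Set (Space d)} {T : Geometry.SimplicialComplex ℝ (Space d)}
    (hT : IsMesh Γ T) (φ : Space d → ℝ) : ∃ w : Space d → ℝ, (∀ x ∉ T.space, w x = 0) ∧
      ∀ s ∈ cells T, ∃ A : Space d →ᵃ[ℝ] ℝ, (∀ v ∈ s, A v = φ v) ∧
        EqOn w A (convexHull ℝ (s : Set (Space d))) := by
  classical
  choose A hA using fun (s : Finset (Space d)) (hs : s ∈ cells T) => exists_affineMap_eqOn hs φ
  choose c hc hxc using fun (x : Space d) (hx : x ∈ T.space) => hT.exists_cell hx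
  refine ⟨fun x => if hx : x ∈ T.space then A (c x hx) (hc x hx) x else 0,
    fun x hx => dif_neg hx, fun s hs => ⟨A s hs, hA s hs, fun x hxs => ?_⟩⟩
  have hx : x ∈ T.space := Geometry.SimplicialComplex.convexHull_subset_space hs.1 hxs
  simp only [hx, dif_pos]
  rw [← sub_eq_zero]
  -- Two cells meet within the hull of their common vertices, where both affine pieces interpolate
  -- `φ`; the chosen cell is therefore immaterial.
  refine eqOn_zero_convexHull (A := A (c x hx) (hc x hx) - A s hs) (s := ↑(c x hx) ∩ ↑s) ?_
    (T.inter_subset_convexHull (hc x hx).1 hs.1 ⟨hxc x hx, hxs⟩)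
  rintro v ⟨hv, hv'⟩
  simp [hA _ (hc x hx) v hv, hA s hs v hv']

/-- The nodal interpolant works. Its support exceeds that of `φ` by at most one cell diameter, hence
by at most `δ`, so it stays inside `Γ` and the interior of the meshed region. -/
theorem exists_interpolant (hd : 1 ≤ d) {Γ : Set (Space d)} (hΓ : IsOpen Γ)
    (hΓb : Bornology.IsBounded Γ) {T : Geometry.SimplicialComplex ℝ (Space d)}
    (hT : IsMesh Γ T) {κ h : ℝ} (hκ : 0 < κ) (hh : 0 < h)
    (hreg : ∀ s ∈ cells T, Metric.diam (convexHull ℝ (s : Set (Space d))) ≤ κ * h ∧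
      ∃ x, Metric.ball x (Metric.diam (convexHull ℝ (s : Set (Space d))) / κ) ⊆
        convexHull ℝ (s : Set (Space d)))
    {φ : Space d → ℝ} (hφ : Differentiable ℝ φ) (hφc : HasCompactSupport φ) {δ : ℝ} (hδ : 0 < δ)
    (hhδ : κ * h ≤ δ) (hcov : Metric.cthickening (2 * δ) (tsupport φ) ⊆ T.space)
    (hδΓ : Metric.cthickening (2 * δ) (tsupport φ) ⊆ Γ) {ε : ℝ}
    (hε : ∀ x y, dist x y ≤ κ * h → ‖fderiv ℝ φ x - fderiv ℝ φ y‖ ≤ ε) :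
    ∃ v ∈ feSpace Γ T, ∀ᵐ x ∂(volume.restrict Γ),
      ‖v.2 x - gradient φ x‖ ≤ (4 * κ + 1) * ε := by
  obtain ⟨w, hw0, hw⟩ := exists_piecewise_affine hT φ
  choose! A hAφ hwA using hw
  have hsupp : ∀ x, w x ≠ 0 → x ∈ Metric.cthickening δ (tsupport φ) := by
    intro x hx
    obtain ⟨s, hs, hxs⟩ := hT.exists_cell (not_not.1 fun hn => hx (hw0 x hn))
    have h1 : ∃ v ∈ (s : Set (Space d)), A s v ≠ 0 := by
      by_contra! hcon
      exact hx ((hwA s hs hxs).trans (eqOn_zero_convexHull hcon hxs))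
    obtain ⟨v, hv, hv0⟩ := h1
    rw [hAφ s hs v hv] at hv0
    exact Metric.mem_cthickening_of_dist_le x v _ _ (subset_tsupport φ hv0)
      ((dist_le_diam_convexHull s hxs (subset_convexHull ℝ _ hv)).trans ((hreg s hs).1.trans hhδ))
  have hthick : Metric.cthickening δ (tsupport φ) ⊆ Metric.thickening (2 * δ) (tsupport φ) :=
    Metric.cthickening_subset_thickening' (by positivity) (by linarith) _
  have hthick' : Metric.cthickening δ (tsupport φ) ⊆ Metric.cthickening (2 * δ) (tsupport φ) :=
    Metric.cthickening_mono (by linarith) _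
  have hZ : ∀ x ∈ (interior T.space)ᶜ, w x = 0 := by
    intro x hx
    by_contra hne
    exact hx (interior_maximal ((Metric.thickening_subset_cthickening _ _).trans hcov)
      Metric.isOpen_thickening (hthick (hsupp x hne)))
  have hφ0 : ∀ x ∉ T.space, x ∉ tsupport φ := fun x hx hxφ =>
    hx (hcov (Metric.self_subset_cthickening _ hxφ))
  have hfin : Finite (cells T) := (cells_finite hT).to_subtype
  -- The exterior piece is the complement of the interior, which is closed; `w` still vanishes
  -- there, so all pieces of the cover are closed with `w` Lipschitz on each.
  let S : Option (cells T) → Set (Space d) := fun o =>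
    o.elim (interior T.space)ᶜ fun s => convexHull ℝ ((s : Finset (Space d)) : Set (Space d))
  have hS : ∀ i, IsClosed (S i) := by
    rintro (_ | s)
    · exact isOpen_interior.isClosed_compl
    · exact isClosed_convexHull_finset _
  have hScov : ∀ x, ∃ i, x ∈ S i := by
    intro x
    by_cases hx : x ∈ T.space
    · obtain ⟨s, hs, hxs⟩ := hT.exists_cell hx
      exact ⟨some ⟨s, hs⟩, hxs⟩
    · exact ⟨none, fun h' => hx (interior_subset h')⟩
  obtain ⟨K, hK⟩ := (finite_range fun s : cells T =>
    ‖LinearMap.toContinuousLinearMap (A s).linear‖₊).bddAbove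
  have hSlip : ∀ i, LipschitzOnWith K w (S i) := by
    rintro (_ | s)
    · intro x hx y hy
      simp [hZ x hx, hZ y hy]
    · intro x hx y hy
      rw [hwA s s.2 hx, hwA s s.2 hy]
      exact ((A s).lipschitzWith_nnnorm_linear.weaken (hK (mem_range_self s))) x y
  have hwcont : Continuous w :=
    (locallyFinite_of_finite S).continuous (iUnion_eq_univ_iff.2 hScov) hS
      fun i => (hSlip i).continuousOn
  have hlip : LipschitzWith K w := lipschitzWith_of_finite_closed_cover hS hScov hwcont hSlip
  have htsupp : tsupport w ⊆ Metric.cthickening δ (tsupport φ) :=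
    closure_minimal (fun x hx => hsupp x hx) Metric.isClosed_cthickening
  have hwc : HasCompactSupport w :=
    hφc.isCompact.cthickening.of_isClosed_subset (isClosed_tsupport w) htsupp
  have hwΓ : tsupport w ⊆ Γ := htsupp.trans (hthick'.trans hδΓ)
  have hfinm : IsFiniteMeasure (volume.restrict Γ) := ⟨by simpa using hΓb.measure_lt_top⟩
  obtain ⟨B, hB⟩ := hwcont.norm.bddAbove_range_of_hasCompactSupport hwc.norm
  have hm1 : MemLp w 2 (volume.restrict Γ) :=
    MemLp.of_bound hwcont.aestronglyMeasurable B
      (Eventually.of_forall fun x => hB (mem_range_self x))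
  have hm2 : MemLp (gradient w) 2 (volume.restrict Γ) := by
    refine MemLp.of_bound ?_ K (Eventually.of_forall fun x => ?_)
    · exact ((InnerProductSpace.toDual ℝ (Space d)).symm.continuous.measurable.comp
        (measurable_fderiv ℝ w)).aestronglyMeasurable
    · rw [norm_gradient]; exact norm_fderiv_le_of_lipschitz ℝ hlip
  refine ⟨(hm1.toLp, hm2.toLp), ⟨mem_H10_of_lipschitzWith hΓ hΓb hlip hwc hwΓ hm1.coeFn_toLp
    hm2.coeFn_toLp, w, hwcont, fun x hx => ?_, fun s hs => ?_, hm1.coeFn_toLp⟩, ?_⟩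
  · by_contra hne
    have hxs := hthick' (hsupp x hne)
    exact hx ⟨hδΓ hxs, hcov hxs⟩
  · obtain ⟨t, ht, hst⟩ := hT.pure s hs
    exact ⟨A t, (hwA t ht).mono (convexHull_mono (by exact_mod_cast hst))⟩
  · filter_upwards [hm2.coeFn_toLp, ae_restrict_of_ae hT.ae_mem_interior] with x hx hxT
    rw [hx, norm_gradient_sub_gradient]
    rcases hxT with hxT | ⟨s, hs, hxs⟩
    · have h1 : w =ᶠ[𝓝 x] fun _ => 0 := by
        filter_upwards [(isClosed_space hT).isOpen_compl.mem_nhds hxT] with y hy using hw0 y hy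
      have h2 : φ =ᶠ[𝓝 x] fun _ => 0 := notMem_tsupport_iff_eventuallyEq.1 (hφ0 x hxT)
      rw [h1.fderiv_eq, h2.fderiv_eq, sub_self, norm_zero]
      have hε0 : 0 ≤ ε := (norm_nonneg _).trans (hε x x (by rw [dist_self]; positivity))
      positivity
    · have h1 : w =ᶠ[𝓝 x] A s := by
        filter_upwards [isOpen_interior.mem_nhds hxs] with y hy using hwA s hs (interior_subset hy)
      rw [h1.fderiv_eq, ((A s).hasFDerivAt_toContinuousLinearMap x).fderiv]
      obtain ⟨hdiam, x₀, hball⟩ := hreg s hs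
      exact norm_linear_interpolant_sub_fderiv_le hκ (diam_cell_pos hd hs) hball hφ
        (fun y hy z hz => hε y z ((dist_le_diam_convexHull s hy hz).trans hdiam)) (hAφ s hs)
        (interior_subset hxs)

/-- The finite element spaces are asymptotically dense in `H¹₀(Γ)`. -/
theorem IsNestedMeshFamily.exists_approx (hd : 1 ≤ d) {Γ : Set (Space d)} (hΓ : IsOpen Γ)
    (hΓb : Bornology.IsBounded Γ) {H : Set ℝ} {T : ℝ → Geometry.SimplicialComplex ℝ (Space d)}
    (hT : IsNestedMeshFamily Γ H T) {u : L2Pair Γ} (hu : u ∈ H10 Γ) {η : ℝ} (hη : 0 < η) :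
    ∃ h₁ : ℝ, 0 < h₁ ∧ ∀ h ∈ H, h ≤ h₁ → ∃ v ∈ feSpace Γ (T h), ‖(u - v).2‖ ≤ η := by
  have hfinm : IsFiniteMeasure (volume.restrict Γ) := ⟨by simpa using hΓb.measure_lt_top⟩
  obtain ⟨q, ⟨φ, hφ, hφc, hφΓ, -, hq2⟩, hqu⟩ :=
    Metric.mem_closure_iff.1 (show u ∈ closure (testPairs Γ : Set (L2Pair Γ)) from hu) (η / 2)
      (by positivity)
  obtain ⟨κ, hκ, hreg⟩ := hT.regular
  obtain ⟨δ', hδ', hδΓ⟩ := hφc.isCompact.exists_cthickening_subset_open hΓ hφΓ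
  obtain ⟨δ, rfl⟩ : ∃ δ, δ' = 2 * δ := ⟨δ' / 2, by ring⟩
  have hδ : 0 < δ := by linarith
  obtain ⟨h₁, hh₁, hcov⟩ := hT.exhausts _ hφc.isCompact.cthickening hδΓ
  -- `M` is the square root of the volume of `Γ`, the factor from a uniform bound to an `L²` bound.
  set M : ℝ := (measureUnivNNReal (volume.restrict Γ) : ℝ) ^ (2 : ENNReal).toReal⁻¹
  have hM : 0 ≤ M := by positivity
  have huc : UniformContinuous (fderiv ℝ φ) :=
    (hφc.fderiv ℝ).uniformContinuous_of_continuous (hφ.continuous_fderiv (by simp))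
  -- Chosen so that the interpolation error `M * ((4 * κ + 1) * ε)` is at most `η / 2`; `M + 1`
  -- avoids division by zero.
  set ε : ℝ := η / (2 * (M + 1) * (4 * κ + 1))
  have hε : 0 < ε := by positivity
  obtain ⟨r, hr, hrε⟩ := Metric.uniformContinuous_iff.1 huc ε hε
  refine ⟨min h₁ (min (δ / κ) (r / (2 * κ))), by positivity, fun h hh hle => ?_⟩
  have hh0 := hT.pos h hh
  have h1 : h ≤ h₁ := hle.trans (min_le_left _ _)
  have h2 : κ * h ≤ δ := by
    have := hle.trans ((min_le_right _ _).trans (min_le_left _ _))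
    rw [le_div_iff₀ hκ] at this
    linarith
  have h3 : κ * h < r := by
    have := hle.trans ((min_le_right _ _).trans (min_le_right _ _))
    rw [le_div_iff₀ (by positivity)] at this
    linarith
  obtain ⟨v, hv, hvφ⟩ := exists_interpolant hd hΓ hΓb (hT.mesh h hh) hκ hh0 (hreg h hh)
    (hφ.differentiable (by simp)) hφc hδ h2 (hcov h hh h1) hδΓ (ε := ε)
    fun x y hxy => by rw [← dist_eq_norm]; exact (hrε (hxy.trans_lt h3)).le
  refine ⟨v, hv, ?_⟩
  have h4 : ‖(q - v).2‖ ≤ M * ((4 * κ + 1) * ε) := by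
    refine Lp.norm_le_of_ae_bound (by positivity) ?_
    filter_upwards [hvφ, hq2, Lp.coeFn_sub q.2 v.2] with x hx hqx hs
    rw [Prod.snd_sub, hs, Pi.sub_apply, hqx, norm_sub_rev]
    exact hx
  have h5 : M * ((4 * κ + 1) * ε) ≤ η / 2 := by
    have : (4 * κ + 1) * ε = η / (2 * (M + 1)) := by
      simp only [ε]; field_simp
    rw [this, mul_div_assoc', div_le_div_iff₀ (by positivity) (by positivity)]
    nlinarith
  have h6 : ‖(u - q).2‖ ≤ η / 2 :=
    (norm_snd_le _).trans ((dist_eq_norm u q) ▸ hqu.le)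
  calc ‖(u - v).2‖ = ‖(u - q).2 + (q - v).2‖ := by
        rw [← Prod.snd_add]; congr 2; abel
    _ ≤ η / 2 + η / 2 := (norm_add_le _ _).trans (add_le_add h6 (h4.trans h5))
    _ = η := by ring

end Interpolation

/-! ### The almost sure error bound. -/

theorem mainTheorem2 {d : ℕ} (hd : 1 ≤ d)
    {Ω : Type*} [MeasurableSpace Ω] (P : Measure Ω) [IsProbabilityMeasure P]
    (Γ : Set (Space d)) (hΓ : IsOpen Γ) (hΓb : Bornology.IsBounded Γ)
    (H : Set ℝ) (T : ℝ → Geometry.SimplicialComplex ℝ (Space d))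
    (hT : IsNestedMeshFamily Γ H T)
    -- conductivity, source term, and observable
    (a f : Ω → Space d → ℝ) (g : Space d → ℝ)
    (ha : ∀ᵐ ω ∂P, IsElliptic Γ (a ω))
    (hf : ∀ᵐ ω ∂P, MemLp (f ω) 2 (volume.restrict Γ))
    (hg : MemLp g 2 (volume.restrict Γ))
    -- primal and dual solutions, exact and discrete
    (u lam : Ω → L2Pair Γ) (uh lamh : Ω → ℝ → L2Pair Γ)
    (hu : ∀ᵐ ω ∂P, SolvesIn (H10 Γ) (a ω) (f ω) (u ω))
    (hlam : ∀ᵐ ω ∂P, SolvesIn (H10 Γ) (a ω) g (lam ω))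
    (huh : ∀ᵐ ω ∂P, ∀ h ∈ H, SolvesIn (feSpace Γ (T h)) (a ω) (f ω) (uh ω h))
    (hlamh : ∀ᵐ ω ∂P, ∀ h ∈ H, SolvesIn (feSpace Γ (T h)) (a ω) g (lamh ω h))
    -- two-sided bound of the estimator for all sufficiently small mesh sizes
    (α β : ℝ) (hα : 0 < α) (hβ : 0 < β) (c C h₀ : Ω → ℝ)
    (hcC : ∀ᵐ ω ∂P, 0 < c ω ∧ 0 < C ω)
    (hF : ∀ᵐ ω ∂P, ∀ h ∈ H, h ≤ h₀ ω →
      c ω ≤ estimator Γ (a ω) (uh ω) (lamh ω) h / h ^ (α + β) ∧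
        estimator Γ (a ω) (uh ω) (lamh ω) h / h ^ (α + β) ≤ C ω) :
    ∀ᵐ ω ∂P, ∀ h ∈ H, h ≤ h₀ ω →
      |galerkinError Γ g (u ω) (uh ω h)| ≤
        C ω * estimator Γ (a ω) (uh ω) (lamh ω) h /
          (c ω * (1 - (2 : ℝ) ^ (-α)) * (1 - (2 : ℝ) ^ (-β))) := by
  filter_upwards [ha, hu, hlam, huh, hlamh, hcC, hF] with ω ha hu hlam huh hlamh hcC hF h hh hle
  have hmem := fun k => hT.div_pow_mem hh k
  have hpos := hT.pos h hh
  have hhalf : ∀ k : ℕ, h / 2 ^ k / 2 = h / 2 ^ (k + 1) := fun k => by rw [pow_succ, div_div]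
  have hle' : ∀ k : ℕ, h / 2 ^ k ≤ h₀ ω := fun k =>
    (div_le_self hpos.le (one_le_pow₀ one_le_two)).trans hle
  obtain ⟨m, M, -, hM, -, hbdd⟩ := ha.exists_bounds
  obtain ⟨B, hB, hcea⟩ := exists_cea_const ha
  let e : ℕ → ℝ := fun k => energyForm Γ (a ω) (lam ω) (u ω - uh ω (h / 2 ^ k))
  have hconv : Tendsto (fun k : ℕ => ‖(u ω - uh ω (h / 2 ^ k)).2‖) atTop (𝓝 0) := by
    rw [Metric.tendsto_atTop]
    intro η hη
    obtain ⟨h₁, hh₁, happ⟩ := hT.exists_approx hd hΓ hΓb hu.1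
      (show 0 < η / (B + 1) by positivity)
    have hlim : Tendsto (fun k : ℕ => h / 2 ^ k) atTop (𝓝 0) :=
      tendsto_const_nhds.div_atTop (tendsto_pow_atTop_atTop_of_one_lt one_lt_two)
    obtain ⟨N, hN⟩ := eventually_atTop.1 (hlim.eventually (ge_mem_nhds hh₁))
    refine ⟨N, fun k hk => ?_⟩
    obtain ⟨v, hv, huv⟩ := happ _ (hmem k) (hN k hk)
    rw [Real.dist_eq, sub_zero, abs_norm]
    calc _ ≤ B * ‖(u ω - v).2‖ :=
          hcea _ _ _ _ _ (feSpace_le_H10 _ _) hu (huh _ (hmem k)) v hv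
      _ ≤ B * (η / (B + 1)) := by gcongr
      _ < η := by
        rw [mul_div_assoc', div_lt_iff₀ (by positivity)]
        nlinarith
  have he : Tendsto e atTop (𝓝 0) := by
    refine squeeze_zero_norm (fun k => hbdd _ _) ?_
    simpa using (hconv.const_mul ‖(lam ω).2‖).const_mul M
  have hstep : ∀ k, |e k - e (k + 1)| ≤ estimator Γ (a ω) (uh ω) (lamh ω) (h / 2 ^ k) := by
    intro k
    have hk1 := hmem (k + 1)
    have hnest := feSpace_mono (hT.mesh _ (hT.half_mem _ (hmem k))) (hT.refines _ (hmem k))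
    rw [hhalf] at hnest
    have h1 : e k - e (k + 1) = energyForm Γ (a ω)
        (uh ω (h / 2 ^ (k + 1)) - uh ω (h / 2 ^ k))
        (lamh ω (h / 2 ^ (k + 1)) - lamh ω (h / 2 ^ k)) := by
      rw [← SolvesIn.energyForm_dual_sub ha (feSpace_le_H10 _ _) hnest (huh _ (hmem k))
        (huh _ hk1) hlam (hlamh _ (hmem k)) (hlamh _ hk1), ← energyForm_sub_right ha]
      congr 1
      abel
    rw [h1, estimator, hhalf]
    exact abs_energyForm_le ha _ _
  -- The dual equation is tested with the error `u - u_h`.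
  have he0 : galerkinError Γ g (u ω) (uh ω h) = e 0 := by
    rw [galerkinError, ← hlam.2 _ ((H10 Γ).sub_mem hu.1 (feSpace_le_H10 _ _ (huh h hh).1))]
    simp [e]
  have key := abs_le_of_geometric_telescoping (e := e)
    (F := fun k => estimator Γ (a ω) (uh ω) (lamh ω) (h / 2 ^ k)) hcC.1 hcC.2 hpos hα hβ he hstep
    (by simpa using (hF h hh hle).1) (fun k => (hF _ (hmem k) (hle' k)).2)
  rw [he0]
  simpa using key
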